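/- **Conventions.** Let $A$ be an F-finite Noetherian normal domain of characteristic $p>0$ with fraction field $L$, and let $q=p^e$ ($e\ge 1$) denote powers of $p$. For a $\mathbb{Q}$-Weil divisor $D$ on $Y=\operatorname{Spec}A$ put $A(D)=\{f\in L \mid f=0 \text{ or } \operatorname{div}_Y(f)+D\ge 0\}$, and let $A(D)^{1/q}\subseteq L^{1/q}$ be the $A$-module of $q$-th roots of elements of $A(D)$. Let $\Delta$ be an effective $\mathbb{Q}$-Weil divisor on $Y$. * $(A,\Delta)$ is *F-pure* if $A\hookrightarrow A((q-1)\Delta)^{1/q}$ splits as an $A$-module homomorphism for every $q=p^e$. * $(A,\Delta)$ is *strongly F-regular* if for every nonzero $c\in A$ there is $q=p^e$ such that $c^{1/q}A\hookrightarrow A((q-1)\Delta)^{1/q}$ splits as an $A$-module homomorphism. * $(A,\Delta)$ is *divisorially F-regular* if for every nonzero $c\in A$ lying in no minimal prime ideal of $A(-\lfloor\Delta\rfloor)\subseteq A$ there is $q=p^e$ such that $c^{1/q}A\hookrightarrow A((q-1)\Delta)^{1/q}$ splits as an $A$-module homomorphism. For an ideal $J$ of a ring of characteristic $p$, $J^{[q]}$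 is the ideal generated by the $q$-th powers of the elements of $J$. **Proposition 2.6 (Fedder-type criteria).** Let $(R,\mathfrak m)$ be an F-finite regular local ring of characteristic $p>0$ and let $I\subset R$ be an ideal such that $A=R/I$ is a normal domain. Let $g\in R\setminus I$ be an element whose image $\bar g\in A$ defines a reduced divisor $\operatorname{div}_Y(\bar g)$ on $Y=\operatorname{Spec}A$ (all its nonzero coefficients are $1$; the zero divisor is allowed). Let $t\ge 0$ be a rational number, $\Delta=t\cdot\operatorname{div}_Y(\bar g)$, and $r_e=\lfloor t(q-1)\rfloor$ for $q=p^e$. Then: 1. $(A,\Delta)$ is F-pure if and only if $g^{r_e}(I^{[q]}:I)\not\subseteq\mathfrak m^{[q]}$ for all $q=p^e$. 2. $(A,\Delta)$ is strongly F-regular if and only if for every $c\in R\setminus I$ there exists $q=p^e$ such that $c\,g^{r_e}(I^{[q]}:I)\not\subseteq\mathfrak m^{[q]}$. 3. $(A,\operatorname{div}_Y(\bar g))$ is divisorially F-regular if and only if for every $c\in R\setminus I$ which is not in any minimal prime of $I+gR$ there exists $q=p^e$ such that $c\,g^{q-1}(I^{[q]}:I)\not\subseteq\mathfrak m^{[q]}$.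 -/

import Mathlib

/-! Pairs `(A, Δ)` of a Noetherian normal domain and an effective `ℚ`-Weil divisor, and their
F-purity, strong F-regularity and divisorial F-regularity. -/

namespace FPairs

/-- The quotient of a ring of prime characteristic `p` by a prime ideal has characteristic `p`. -/
instance charP_quotient {R : Type*} [CommRing R] (p : ℕ) [Fact p.Prime] [CharP R p]
    (I : Ideal R) [I.IsPrime] : CharP (R ⧸ I) p := by
  have h : ((p : ℕ) : R ⧸ I) = 0 := by
    rw [← map_natCast (Ideal.Quotient.mk I), CharP.cast_eq_zero, map_zero]
  exact (CharP.charP_iff_prime_eq_zero (Fact.out : p.Prime)).2 h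

/-- The ideal `I^{[q]}` generated by the `q`-th powers of the elements of `I`. -/
def frobeniusPower {R : Type*} [CommRing R] (I : Ideal R) (q : ℕ) : Ideal R :=
  Ideal.span ((fun x => x ^ q) '' (I : Set R))

/-- A ring of characteristic `p` is F-finite if its Frobenius endomorphism is a finite map. -/
def IsFFinite (R : Type*) [CommRing R] (p : ℕ) [Fact p.Prime] [CharP R p] : Prop :=
  (frobenius R p).Finite

section Divisors

/-- The points of codimension one of `Spec A`, i.e. the prime Weil divisors. -/
def PrimeDivisor (A : Type*) [CommRing A] : Type _ :=
  {P : PrimeSpectrum A // P.asIdeal.height = 1}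

variable {A : Type*} [CommRing A] [IsDomain A] [IsNoetherianRing A] [IsIntegrallyClosed A]

/-- The local ring `A_P` of a prime divisor `P`. -/
abbrev PrimeDivisor.LocalRing (P : PrimeDivisor A) : Type _ :=
  Localization.AtPrime P.1.asIdeal

/-- The local ring of a normal Noetherian domain at a prime divisor is a discrete valuation
ring. -/
instance PrimeDivisor.isDVR (P : PrimeDivisor A) : IsDiscreteValuationRing P.LocalRing := by
  have hdim : ringKrullDim P.LocalRing = 1 := by
    rw [IsLocalization.AtPrime.ringKrullDim_eq_height P.1.asIdeal P.LocalRing, P.2]; rfl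
  have hnf : ¬ IsField P.LocalRing := fun h => by
    rw [ringKrullDim_eq_zero_of_isField h] at hdim
    exact zero_ne_one hdim
  have hic : IsIntegrallyClosed P.LocalRing :=
    isIntegrallyClosed_of_isLocalization P.LocalRing P.1.asIdeal.primeCompl
      P.1.asIdeal.primeCompl_le_nonZeroDivisors
  have huniq : ∀ Q : Ideal P.LocalRing, Q ≠ ⊥ ∧ Q.IsPrime →
      Q = IsLocalRing.maximalIdeal P.LocalRing := by
    rintro Q ⟨hQ0, hQ⟩
    have : Ring.KrullDimLE 1 P.LocalRing := by
      rw [Ring.krullDimLE_iff, hdim]; rfl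
    exact IsLocalRing.eq_maximalIdeal (hQ.isMaximal_of_ne_bot hQ0)
  have hex : ∃! Q : Ideal P.LocalRing, Q ≠ ⊥ ∧ Q.IsPrime :=
    ⟨IsLocalRing.maximalIdeal P.LocalRing,
      ⟨fun h => hnf (IsLocalRing.isField_iff_maximalIdeal_eq.2 h), inferInstance⟩, huniq⟩
  have htfae := (IsDiscreteValuationRing.TFAE P.LocalRing hnf).out 0 3
  exact htfae.2 ⟨hic, hex⟩

/-- The normalized valuation of the function field given by the discrete valuation ring `A_P`,
written multiplicatively. -/
noncomputable def PrimeDivisor.valuation (P : PrimeDivisor A) :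
    Valuation (FractionRing A) (WithZero (Multiplicative ℤ)) :=
  (IsDiscreteValuationRing.maximalIdeal P.LocalRing).valuation (FractionRing A)

/-- The order `v_P(f)` of a rational function `f ≠ 0` along the prime divisor `P`
(with value `0` at `f = 0`). -/
noncomputable def PrimeDivisor.ord (P : PrimeDivisor A) (f : FractionRing A) : ℤ :=
  -WithZero.log (P.valuation f)

theorem PrimeDivisor.ord_algebraMap_nonneg (P : PrimeDivisor A) (a : A) :
    0 ≤ P.ord (algebraMap A (FractionRing A) a) := by
  by_cases ha : a = 0
  · simp [PrimeDivisor.ord, ha]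
  have h1 : P.valuation (algebraMap A (FractionRing A) a) ≤ 1 := by
    rw [IsScalarTower.algebraMap_apply A P.LocalRing (FractionRing A)]
    exact IsDedekindDomain.HeightOneSpectrum.valuation_le_one _ _
  have h0 : P.valuation (algebraMap A (FractionRing A) a) ≠ 0 := by
    simpa using ha
  have := (WithZero.log_le_log h0 one_ne_zero).2 h1
  simp only [WithZero.log_one] at this
  simp only [PrimeDivisor.ord]
  omega

theorem PrimeDivisor.ord_algebraMap_of_notMem (P : PrimeDivisor A) {a : A}
    (ha : a ∉ P.1.asIdeal) : P.ord (algebraMap A (FractionRing A) a) = 0 := by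
  have h1 : P.valuation (algebraMap A (FractionRing A) a) = 1 := by
    rw [IsScalarTower.algebraMap_apply A P.LocalRing (FractionRing A)]
    refine (IsDedekindDomain.HeightOneSpectrum.valuation_eq_one_iff_notMem _).2 fun h => ha ?_
    exact (IsLocalization.AtPrime.to_map_mem_maximal_iff P.LocalRing P.1.asIdeal a).1 h
  simp [PrimeDivisor.ord, h1]

/-- A nonzero rational function has nonzero order along only finitely many prime divisors. -/
theorem finite_support_ord (f : FractionRing A) :
    (Function.support fun P : PrimeDivisor A => (P.ord f : ℚ)).Finite := by
  obtain ⟨a, b, hb, rfl⟩ := IsFractionRing.div_surjective A f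
  have hb0 : b ≠ 0 := nonZeroDivisors.ne_zero hb
  by_cases ha0 : a = 0
  · simp [PrimeDivisor.ord, ha0]
  have hab : a * b ≠ 0 := mul_ne_zero ha0 hb0
  have hfin : (Ideal.span {a * b}).minimalPrimes.Finite :=
    Ideal.finite_minimalPrimes_of_isNoetherianRing A _
  refine Set.Finite.of_finite_image (f := fun P : PrimeDivisor A => P.1.asIdeal)
    (hfin.subset ?_) ?_
  · rintro _ ⟨P, hP, rfl⟩
    have hmem : a * b ∈ P.1.asIdeal := by
      by_contra hnot
      apply hP
      have ha : a ∉ P.1.asIdeal := fun h => hnot (Ideal.mul_mem_right _ _ h)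
      have hb : b ∉ P.1.asIdeal := fun h => hnot (Ideal.mul_mem_left _ _ h)
      have hva : P.valuation (algebraMap A (FractionRing A) a) ≠ 0 := by simpa using ha0
      have hvb : P.valuation (algebraMap A (FractionRing A) b) ≠ 0 := by simpa using hb0
      have h1 := P.ord_algebraMap_of_notMem ha
      have h2 := P.ord_algebraMap_of_notMem hb
      simp only [PrimeDivisor.ord] at h1 h2 ⊢
      rw [map_div₀, WithZero.log_div hva hvb]
      have : -(WithZero.log (P.valuation (algebraMap A (FractionRing A) a))
        - WithZero.log (P.valuation (algebraMap A (FractionRing A) b))) = 0 := by omega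
      rw [this, Int.cast_zero]
    refine Ideal.mem_minimalPrimes_of_height_le
      ((Ideal.span_singleton_le_iff_mem _).2 hmem) ?_
    rw [P.2]
    exact Ideal.one_le_height_span_singleton_of_mem_nonZeroDivisors
      (mem_nonZeroDivisors_of_ne_zero hab)
  · intro P _ Q _ h
    exact Subtype.ext (PrimeSpectrum.ext h)

variable (A) in
/-- `ℚ`-Weil divisors on `Spec A`: finite formal `ℚ`-linear combinations of prime divisors, with
coefficientwise order. -/
abbrev QDivisor : Type _ := PrimeDivisor A →₀ ℚ

/-- The round-down of a `ℚ`-divisor. -/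
noncomputable def QDivisor.roundDown (D : QDivisor A) : QDivisor A :=
  D.mapRange (fun r => (⌊r⌋ : ℚ)) (by simp)

/-- A divisor is reduced if each of its components occurs with coefficient one. -/
def QDivisor.IsReduced (D : QDivisor A) : Prop :=
  ∀ P ∈ D.support, D P = 1

/-- The principal divisor `div(f) = ∑ v_P(f) P` of a rational function `f ≠ 0`. -/
noncomputable def div (f : FractionRing A) : QDivisor A :=
  Finsupp.ofSupportFinite (fun P => (P.ord f : ℚ)) (finite_support_ord f)

theorem div_algebraMap_nonneg (a : A) : 0 ≤ div (algebraMap A (FractionRing A) a) := fun P =>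
  Int.cast_nonneg (P.ord_algebraMap_nonneg a)

/-- `A(D) = {f | f = 0 or div(f) + D ≥ 0}`, an `A`-submodule of the fraction field. -/
noncomputable def sections (D : QDivisor A) : Submodule A (FractionRing A) where
  carrier := {f | f = 0 ∨ 0 ≤ div f + D}
  zero_mem' := Or.inl rfl
  add_mem' := by
    rintro f g hf hg
    by_cases hf0 : f = 0
    · simpa [hf0] using hg
    by_cases hg0 : g = 0
    · simpa [hg0] using hf
    by_cases hfg : f + g = 0
    · exact Or.inl hfg
    have hf := hf.resolve_left hf0
    have hg := hg.resolve_left hg0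
    refine Or.inr fun P => ?_
    have hfP : (0 : ℚ) ≤ P.ord f + D P := hf P
    have hgP : (0 : ℚ) ≤ P.ord g + D P := hg P
    change (0 : ℚ) ≤ P.ord (f + g) + D P
    have hle : min (P.ord f) (P.ord g) ≤ P.ord (f + g) := by
      have hv0 : P.valuation (f + g) ≠ 0 := by simpa using hfg
      have hvf : P.valuation f ≠ 0 := by simpa using hf0
      have hvg : P.valuation g ≠ 0 := by simpa using hg0
      simp only [PrimeDivisor.ord]
      rcases le_max_iff.1 (P.valuation.map_add f g) with h | h
      · have := (WithZero.log_le_log hv0 hvf).2 h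
        omega
      · have := (WithZero.log_le_log hv0 hvg).2 h
        omega
    rcases min_le_iff.1 hle with h | h
    · have : (P.ord f : ℚ) ≤ P.ord (f + g) := by exact_mod_cast h
      linarith
    · have : (P.ord g : ℚ) ≤ P.ord (f + g) := by exact_mod_cast h
      linarith
  smul_mem' := by
    rintro a f (rfl | hf)
    · exact Or.inl (smul_zero a)
    by_cases haf : a • f = 0
    · exact Or.inl haf
    refine Or.inr fun P => ?_
    have hfP : (0 : ℚ) ≤ P.ord f + D P := hf P
    change (0 : ℚ) ≤ P.ord (a • f) + D P
    rw [Algebra.smul_def] at haf ⊢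
    have hva : P.valuation (algebraMap A (FractionRing A) a) ≠ 0 :=
      (Valuation.ne_zero_iff _).2 (left_ne_zero_of_mul haf)
    have hvf : P.valuation f ≠ 0 := (Valuation.ne_zero_iff _).2 (right_ne_zero_of_mul haf)
    have ha := P.ord_algebraMap_nonneg a
    have hmul : P.ord (algebraMap A (FractionRing A) a * f)
        = P.ord (algebraMap A (FractionRing A) a) + P.ord f := by
      simp only [PrimeDivisor.ord]
      rw [map_mul, WithZero.log_mul hva hvf]
      ring
    have ha' : (0 : ℚ) ≤ P.ord (algebraMap A (FractionRing A) a) := by exact_mod_cast ha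
    rw [hmul]
    push_cast
    linarith

/-- `A ⊆ A(D)` for an effective divisor `D`. -/
theorem algebraMap_mem_sections {D : QDivisor A} (hD : 0 ≤ D) (c : A) :
    algebraMap A (FractionRing A) c ∈ sections D :=
  Or.inr (add_nonneg (div_algebraMap_nonneg c) hD)

/-- The ideal `A(-⌊D⌋) ∩ A` of `A`; for an effective `D` this is `A(-⌊D⌋)` itself. -/
noncomputable def roundDownIdeal (D : QDivisor A) : Ideal A :=
  (sections (-D.roundDown)).comap (Algebra.linearMap A (FractionRing A))

end Divisors

section Pairs

set_option linter.unusedVariables false in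
/-- For an `A`-submodule `M` of the fraction field `L` and `q = p ^ e`, the `A`-module
`M^{1/q} ⊆ L^{1/q}`: via `x ↦ x^{1/q}` it is the additive group `M` on which `a ∈ A` acts as
multiplication by `a ^ q`, since `a * x^{1/q} = (a ^ q * x)^{1/q}`. -/
def Root (A : Type*) [CommRing A] (p e : ℕ) (M : Type*) : Type _ := M

instance (A : Type*) [CommRing A] (p e : ℕ) (M : Type*) [AddCommGroup M] :
    AddCommGroup (Root A p e M) := inferInstanceAs (AddCommGroup M)

noncomputable instance (A : Type*) [CommRing A] (p e : ℕ) [ExpChar A p] (M : Type*)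
    [AddCommGroup M] [Module A M] : Module A (Root A p e M) :=
  Module.compHom M (iterateFrobenius A p e)

/-- The element `x^{1/q}` of `M^{1/q}`. -/
def Root.mk (A : Type*) [CommRing A] (p e : ℕ) {M : Type*} (x : M) : Root A p e M := x

theorem Root.smul_mk {A : Type*} [CommRing A] (p e : ℕ) [ExpChar A p] {M : Type*}
    [AddCommGroup M] [Module A M] (a : A) (x : M) :
    a • Root.mk A p e x = Root.mk A p e (a ^ p ^ e • x) := rfl

theorem qDivisor_nonneg {A : Type*} [CommRing A] (p : ℕ) [Fact p.Prime] (e : ℕ)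
    {D : PrimeDivisor A →₀ ℚ} (hD : 0 ≤ D) : 0 ≤ ((p : ℚ) ^ e - 1) • D :=
  smul_nonneg (sub_nonneg.2 (one_le_pow₀ (by exact_mod_cast (Fact.out : p.Prime).one_le))) hD

variable {A : Type*} [CommRing A] [IsDomain A] [IsNoetherianRing A] [IsIntegrallyClosed A]
  (p : ℕ) [Fact p.Prime] [CharP A p]

/-- The `A`-linear map `A → A(D)^{1/q}`, `a ↦ a * c^{1/q}`, for `D` effective. -/
noncomputable def rootMap (e : ℕ) (D : QDivisor A) (hD : 0 ≤ D) (c : A) :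
    A →ₗ[A] Root A p e (sections D) :=
  LinearMap.toSpanSingleton A (Root A p e (sections D))
    (Root.mk A p e
      (⟨algebraMap A (FractionRing A) c, algebraMap_mem_sections hD c⟩ : sections D))

/-- `c^{1/q} A → A(D)^{1/q}` splits as a homomorphism of `A`-modules. -/
def Splits (e : ℕ) (D : QDivisor A) (hD : 0 ≤ D) (c : A) : Prop :=
  ∃ φ : Root A p e (sections D) →ₗ[A] A, φ ∘ₗ rootMap p e D hD c = LinearMap.id

/-- `(A, D)` is F-pure: `A → A((q-1)D)^{1/q}` splits for every `q = p ^ e`. -/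
def IsFPure (D : QDivisor A) (hD : 0 ≤ D) : Prop :=
  ∀ e : ℕ, 1 ≤ e → Splits p e (((p : ℚ) ^ e - 1) • D) (qDivisor_nonneg p e hD) 1

/-- `(A, D)` is strongly F-regular: for every `c ≠ 0` there is `q = p ^ e` such that
`c^{1/q} A → A((q-1)D)^{1/q}` splits. -/
def IsStronglyFRegular (D : QDivisor A) (hD : 0 ≤ D) : Prop :=
  ∀ c : A, c ≠ 0 → ∃ e : ℕ, 1 ≤ e ∧ Splits p e (((p : ℚ) ^ e - 1) • D) (qDivisor_nonneg p e hD) c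

/-- `(A, D)` is divisorially F-regular: the same for all `c ≠ 0` that lie in no minimal prime
of the ideal `A(-⌊D⌋)`. -/
def IsDivisoriallyFRegular (D : QDivisor A) (hD : 0 ≤ D) : Prop :=
  ∀ c : A, c ≠ 0 → (∀ Q ∈ (roundDownIdeal D).minimalPrimes, c ∉ Q) →
    ∃ e : ℕ, 1 ≤ e ∧ Splits p e (((p : ℚ) ^ e - 1) • D) (qDivisor_nonneg p e hD) c

end Pairs

/-- The principal divisor `div_Y(ḡ)` on `Y = Spec (R/I)` of the image `ḡ` of `g ∈ R`. -/
noncomputable def divMk {R : Type*} [CommRing R] [IsNoetherianRing R] (I : Ideal R) [I.IsPrime]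
    [IsIntegrallyClosed (R ⧸ I)] (g : R) : QDivisor (R ⧸ I) :=
  div (algebraMap (R ⧸ I) (FractionRing (R ⧸ I)) (Ideal.Quotient.mk I g))

theorem divMk_nonneg {R : Type*} [CommRing R] [IsNoetherianRing R] (I : Ideal R) [I.IsPrime]
    [IsIntegrallyClosed (R ⧸ I)] (g : R) : 0 ≤ divMk I g :=
  div_algebraMap_nonneg _

theorem smul_divMk_nonneg {R : Type*} [CommRing R] [IsNoetherianRing R] (I : Ideal R) [I.IsPrime]
    [IsIntegrallyClosed (R ⧸ I)] (g : R) {t : ℚ} (ht : 0 ≤ t) : 0 ≤ t • divMk I g :=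
  smul_nonneg ht (divMk_nonneg I g)

end FPairs

/-! The proof is Fedder's argument, after the divisor has been absorbed into the element to be
split.

Since `div(ḡ)` is reduced and orders are integers, `A(s div(ḡ)) = ḡ^{-⌊s⌋} A`; this rests on a
normal Noetherian domain being the intersection of its localizations at height-one primes.
Multiplication by `ḡ^{⌊s⌋}` therefore turns each splitting into an `A`-linear `ψ : A^{1/q} → A` with
`ψ(h^{1/q}) = 1`, where `h = c g^{⌊s⌋}` (`splits_smul_div_iff`).

Over the F-finite regular local ring `R` the module `R^{1/q}` is finite free (`FrobeniusRoot.free`).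
Hence such a `ψ` exists exactly when some `R`-linear `φ : R^{1/q} → R` maps `I^{1/q}` into `I` and
`h^{1/q}` to a unit: maps lift by projectivity, descend to quotients and can be rescaled.

The closed fibre of `R → R^{1/q}` is `R/m^{[q]}`. As `m` is generated by a regular sequence `x₁, …,
x_d`, every nonzero ideal of this fibre contains the class of `(x₁ ⋯ x_d)^{q-1}`
(`exists_notMem_forall_exists_mul_sub_mem`). A functional taking the value 1 on this class has an
invertible Gram matrix, so it generates `Hom_R(R^{1/q}, R)` over `R^{1/q}`
(`exists_dual_forall_exists_eq_apply_mul`). Multipliers of the generator that preserve `I` form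
`(I^{[q]} : I)`, and a unit value at `h` is available exactly when `h (I^{[q]} : I) ⊄ m^{[q]}`. -/

open IsLocalRing RingTheory.Sequence

/-! ### Regular local rings and regular sequences generating the maximal ideal -/

/-- Dividing a Noetherian local ring by an element of `m ∖ m²` lowers the minimal number of
generators of the maximal ideal. -/
theorem spanFinrank_maximalIdeal_quotient_lt {R : Type*} [CommRing R] [IsLocalRing R]
    [IsNoetherianRing R] {x : R} (hx : x ∈ maximalIdeal R) (hx2 : x ∉ maximalIdeal R ^ 2)
    [IsLocalRing (R ⧸ Ideal.span {x})] :
    (maximalIdeal (R ⧸ Ideal.span {x})).spanFinrank + 1 ≤ (maximalIdeal R).spanFinrank := by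
  classical
  obtain ⟨s, hscard, hs⟩ := Submodule.FG.exists_span_finset_card_eq_spanFinrank
    (maximalIdeal R).fg_of_isNoetherianRing
  have hxs : x ∈ Submodule.span R (s : Set R) := hs ▸ hx
  obtain ⟨a, ha⟩ := Submodule.mem_span_finset.1 hxs
  have hsm : ∀ y ∈ s, y ∈ maximalIdeal R := fun y hy => hs ▸ Submodule.subset_span hy
  -- As `x ∉ m²`, some coefficient of `x` in a minimal generating set is a unit; that generator
  -- becomes redundant modulo `x`.
  obtain ⟨y, hys, hy⟩ : ∃ y ∈ s, IsUnit (a y) := by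
    by_contra! h
    apply hx2
    rw [← ha.2, pow_two]
    exact Ideal.sum_mem _ fun y hy => Ideal.mul_mem_mul ((mem_maximalIdeal _).2 (h y hy)) (hsm y hy)
  set f := Ideal.Quotient.mk (Ideal.span {x})
  have hmap : maximalIdeal (R ⧸ Ideal.span {x}) = Ideal.span (f '' (s.erase y : Finset R)) := by
    have h1 : maximalIdeal (R ⧸ Ideal.span {x}) = (maximalIdeal R).map f :=
      (map_maximalIdeal_of_surjective _ Ideal.Quotient.mk_surjective).symm
    have h2 : (maximalIdeal R).map f = Ideal.span (f '' (s : Set R)) := by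
      rw [← Ideal.map_span]; congr 1; exact hs.symm
    rw [h1, h2]
    refine le_antisymm (Ideal.span_le.2 ?_) (Ideal.span_mono (Set.image_mono (by simp)))
    rintro _ ⟨z, hz, rfl⟩
    by_cases hzy : z = y
    · subst hzy
      have h3 : f (a z) * f z = - ∑ w ∈ s.erase z, f (a w) * f w := by
        have : f (∑ w ∈ s, a w • w) = 0 := by
          rw [ha.2]; exact Ideal.Quotient.eq_zero_iff_mem.2 (Ideal.mem_span_singleton_self x)
        rw [← Finset.add_sum_erase s _ hys, map_add, map_sum] at this
        simp only [smul_eq_mul, map_mul] at this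
        exact eq_neg_of_add_eq_zero_left this
      have h4 : f (a z) * f z ∈ Ideal.span (f '' (s.erase z : Finset R)) := by
        rw [h3]
        exact neg_mem (Ideal.sum_mem _ fun w hw => Ideal.mul_mem_left _ _
          (Ideal.subset_span ⟨w, hw, rfl⟩))
      exact (Ideal.unit_mul_mem_iff_mem _ (hy.map f)).1 h4
    · exact Ideal.subset_span ⟨z, by simpa [hzy] using hz, rfl⟩
  have h5 := Submodule.spanFinrank_span_le_ncard_of_finite (R := R ⧸ Ideal.span {x})
    ((s.erase y).finite_toSet.image f)
  have h6 : (f '' (s.erase y : Finset R)).ncard ≤ s.card - 1 := by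
    refine (Set.ncard_image_le (s.erase y).finite_toSet).trans ?_
    rw [Set.ncard_coe_finset, Finset.card_erase_of_mem hys]
  have h7 : 0 < s.card := Finset.card_pos.2 ⟨y, hys⟩
  rw [hmap]
  change (Submodule.span _ _).spanFinrank + 1 ≤ _
  omega

/-- A Noetherian local ring of nonzero dimension has an element of `m ∖ m²` outside all minimal
primes. -/
theorem exists_mem_maximalIdeal_notMem_sq_notMem_minimalPrimes {R : Type*} [CommRing R]
    [IsLocalRing R] [IsNoetherianRing R] (h0 : ringKrullDim R ≠ 0) :
    ∃ x ∈ maximalIdeal R, x ∉ maximalIdeal R ^ 2 ∧ ∀ Q ∈ minimalPrimes R, x ∉ Q := by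
  classical
  by_contra! h
  have hfin := minimalPrimes.finite_of_isNoetherianRing R
  -- Prime avoidance tolerates up to two ideals that are not prime; here `m²` fills both exceptional
  -- places.
  have key := (Ideal.subset_union_prime (s := insert (maximalIdeal R ^ 2) hfin.toFinset)
    (f := id) (I := maximalIdeal R) (maximalIdeal R ^ 2) (maximalIdeal R ^ 2) (by
      intro i hi h1 _
      have : i ∈ minimalPrimes R := by simpa [h1] using hi
      exact this.1.1)).1 (by
    intro x hx
    simp only [Set.mem_iUnion]
    by_cases hx2 : x ∈ maximalIdeal R ^ 2
    · exact ⟨maximalIdeal R ^ 2, by simp, hx2⟩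
    · obtain ⟨Q, hQ, hxQ⟩ := h x hx hx2
      exact ⟨Q, by simp [hQ], hxQ⟩)
  obtain ⟨Q, hQ, hmQ⟩ := key
  apply h0
  have hmin : maximalIdeal R ∈ minimalPrimes R := by
    rcases Finset.mem_insert.1 hQ with rfl | hQ
    · have hbot : maximalIdeal R = ⊥ := by
        refine Submodule.eq_bot_of_le_smul_of_le_jacobson_bot (maximalIdeal R) _
          (maximalIdeal R).fg_of_isNoetherianRing ?_ (maximalIdeal_le_jacobson _)
        simpa [pow_two] using hmQ
      exact ⟨⟨inferInstance, bot_le⟩, fun Q _ _ => hbot ▸ bot_le⟩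
    · have hQ' : Q ∈ minimalPrimes R := by simpa using hQ
      have := hQ'.1.1
      have : Q = maximalIdeal R := le_antisymm (le_maximalIdeal this.ne_top) hmQ
      exact this ▸ hQ'
  rw [← maximalIdeal_height_eq_ringKrullDim, Ideal.height_eq_zero_iff.2 hmin]
  rfl

/-- `R / xR` as a module over itself is isomorphic to the quotient module `R / x • R`. -/
noncomputable def quotSMulTopSelfEquiv {R : Type*} [CommRing R] (x : R) :
    (R ⧸ Ideal.span {x}) ≃ₗ[R ⧸ Ideal.span {x}] QuotSMulTop x R :=
  (Submodule.quotEquivOfEq _ _ (by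
    ext y
    simp [Ideal.mem_span_singleton', Submodule.mem_smul_pointwise_iff_exists, mul_comm]) :
    (R ⧸ Ideal.span {x}) ≃ₗ[R] QuotSMulTop x R).extendScalarsOfSurjective
      Ideal.Quotient.mk_surjective

/-- The embedding dimension drops by at least one and the Krull dimension by at most one. They agree
for `R`, and the Krull dimension never exceeds the embedding dimension, so both drop by exactly one.
-/
theorem IsRegularLocalRing.quotient_span_singleton {R : Type*} [CommRing R] [IsRegularLocalRing R]
    {x : R} (hx : x ∈ maximalIdeal R) (hx2 : x ∉ maximalIdeal R ^ 2) :
    IsRegularLocalRing (R ⧸ Ideal.span {x}) ∧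
      ringKrullDim (R ⧸ Ideal.span {x}) + 1 = ringKrullDim R := by
  have : Nontrivial (R ⧸ Ideal.span {x}) := Ideal.Quotient.nontrivial_iff.2 fun h =>
    (maximalIdeal.isMaximal R).ne_top (top_le_iff.1 (h ▸ (Ideal.span_singleton_le_iff_mem _).2 hx))
  have : IsLocalRing (R ⧸ Ideal.span {x}) :=
    .of_surjective' _ Ideal.Quotient.mk_surjective
  have h1 := spanFinrank_maximalIdeal_quotient_lt hx hx2
  have h2 : ringKrullDim R ≤ ringKrullDim (R ⧸ Ideal.span {x}) + 1 := by
    have := ringKrullDim_le_ringKrullDim_quotient_add_card {x} (by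
      simpa [ringJacobson_eq_maximalIdeal] using hx)
    rwa [Finset.coe_singleton, Finset.card_singleton, Nat.cast_one] at this
  have h3 := IsRegularLocalRing.spanFinrank_maximalIdeal (R := R)
  have h4 := ringKrullDim_le_spanFinrank_maximalIdeal (R ⧸ Ideal.span {x})
  have h5 : (((maximalIdeal (R ⧸ Ideal.span {x})).spanFinrank + 1 : ℕ) : WithBot ℕ∞) ≤
    ringKrullDim R := by rw [← h3]; exact_mod_cast h1
  push_cast at h5
  have h6 := ENat.WithBot.add_le_add_one_right_iff.1 (h5.trans h2)
  refine ⟨IsRegularLocalRing.of_spanFinrank_maximalIdeal_le _ h6, le_antisymm ?_ h2⟩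
  exact (add_le_add_left h4 1).trans h5

/-- The maximal ideal of a regular local ring is generated by a regular sequence; moreover the
ring is a domain. -/
theorem IsRegularLocalRing.isDomain_and_exists_isWeaklyRegular (n : ℕ) :
    ∀ (R : Type*) [CommRing R] [IsRegularLocalRing R], ringKrullDim R = n →
      IsDomain R ∧ ∃ rs : List R, IsWeaklyRegular R rs ∧ Ideal.ofList rs = maximalIdeal R := by
  induction n with
  | zero =>
    intro R _ _ h
    have h3 := IsRegularLocalRing.spanFinrank_maximalIdeal (R := R)
    rw [h] at h3
    have hbot : maximalIdeal R = ⊥ :=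
      (Submodule.spanFinrank_eq_zero_iff_eq_bot (maximalIdeal R).fg_of_isNoetherianRing).1
        (by exact_mod_cast h3)
    have hf : IsField R := isField_iff_maximalIdeal_eq.2 hbot
    exact ⟨hf.isDomain, [], .nil _ _, by simp [hbot]⟩
  | succ n ih =>
    intro R _ _ h
    obtain ⟨x, hx, hx2, hxQ⟩ := exists_mem_maximalIdeal_notMem_sq_notMem_minimalPrimes (R := R)
      (by rw [h]; exact_mod_cast n.succ_ne_zero)
    obtain ⟨hreg, hdim⟩ := IsRegularLocalRing.quotient_span_singleton hx hx2
    obtain ⟨hdom, rs, hrs, hm⟩ := ih (R ⧸ Ideal.span {x}) (by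
      rw [h, Nat.cast_add, Nat.cast_one] at hdim
      exact ENat.WithBot.add_one_cancel.1 hdim)
    have hP : (Ideal.span {x}).IsPrime := (Ideal.Quotient.isDomain_iff_prime _).1 hdom
    obtain ⟨Q, hQ, hQx⟩ := Ideal.exists_minimalPrimes_le (I := ⊥) (J := Ideal.span {x}) bot_le
    -- Since `Q ⊆ (x)` and `x ∉ Q`, primality gives `Q = xQ`; Nakayama then forces `Q = 0`.
    have hQbot : Q = ⊥ := by
      refine Submodule.eq_bot_of_le_smul_of_le_jacobson_bot (maximalIdeal R) _
        Q.fg_of_isNoetherianRing ?_ (maximalIdeal_le_jacobson _)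
      intro y hy
      obtain ⟨z, rfl⟩ := Ideal.mem_span_singleton'.1 (hQx hy)
      have hz : z ∈ Q := (hQ.1.1.mem_or_mem hy).resolve_right (hxQ Q hQ)
      rw [mul_comm]
      exact Ideal.mul_mem_mul hx hz
    have hRdom : IsDomain R := by
      have := hQ.1.1
      rw [hQbot] at this
      exact IsDomain.of_bot_isPrime R
    have hx0 : x ≠ 0 := fun h0 => hx2 (h0 ▸ zero_mem _)
    obtain ⟨rs', rfl⟩ : ∃ rs' : List R, rs'.map (Ideal.Quotient.mk (Ideal.span {x})) = rs :=
      List.map_surjective_iff.2 Ideal.Quotient.mk_surjective rs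
    refine ⟨hRdom, x :: rs', .cons' ?_ ?_, ?_⟩
    · exact (IsRegular.of_ne_zero hx0).left.isSMulRegular
    · exact ((quotSMulTopSelfEquiv x).isWeaklyRegular_congr _).1 hrs
    · rw [Ideal.ofList_cons]
      rw [← Ideal.map_ofList, ← map_maximalIdeal_of_surjective _ Ideal.Quotient.mk_surjective] at hm
      have := congrArg (Ideal.comap (Ideal.Quotient.mk (Ideal.span {x}))) hm
      rw [Ideal.comap_map_of_surjective _ Ideal.Quotient.mk_surjective,
        Ideal.comap_map_of_surjective _ Ideal.Quotient.mk_surjective] at this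
      simp only [← RingHom.ker_eq_comap_bot, Ideal.mk_ker] at this
      rw [sup_comm, this]
      exact sup_eq_left.2 ((Ideal.span_singleton_le_iff_mem _).2 hx)

theorem IsRegularLocalRing.exists_isWeaklyRegular (R : Type*) [CommRing R] [IsRegularLocalRing R] :
    ∃ rs : List R, IsWeaklyRegular R rs ∧ Ideal.ofList rs = maximalIdeal R :=
  (IsRegularLocalRing.isDomain_and_exists_isWeaklyRegular _ R
    IsRegularLocalRing.spanFinrank_maximalIdeal.symm).2

theorem mem_ofList_of_mul_mem {R : Type*} [CommRing R] {rs : List R} {x a : R} (h : IsWeaklyRegular R (rs ++ [x]))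
    (ha : x * a ∈ Ideal.ofList rs) : a ∈ Ideal.ofList rs := by
  rw [isWeaklyRegular_append_iff, isWeaklyRegular_singleton_iff] at h
  have h1 : (Ideal.ofList rs • ⊤ : Submodule R R) = Ideal.ofList rs := by simp
  have h2 := h.2 (a₁ := Submodule.Quotient.mk a) (a₂ := 0) (by
    change x • _ = x • _
    rw [smul_zero, ← Submodule.Quotient.mk_smul, Submodule.Quotient.mk_eq_zero, h1]
    exact ha)
  rwa [Submodule.Quotient.mk_eq_zero, h1] at h2

/-! ### Powers of regular sequences and the socle modulo `(x₁^q, …, x_d^q)` -/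

section RegularSequences

variable {R : Type*} [CommRing R] [IsLocalRing R] [IsNoetherianRing R]

/-- Replacing elements of a regular sequence by positive powers gives a regular sequence. -/
theorem isWeaklyRegular_map_pow_append {q : ℕ} (hq : q ≠ 0) {rs : List R} :
    ∀ {post : List R}, (∀ r ∈ rs ++ post, r ∈ maximalIdeal R) → IsWeaklyRegular R (rs ++ post) →
      IsWeaklyRegular R (rs.map (· ^ q) ++ post) := by
  induction rs with
  | nil => exact fun _ h => h
  | cons x l ih =>
    intro post hm h
    -- Regular sequences in `m` may be permuted. So `x` is moved to the end, where passing to `x ^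
    -- q` only uses that powers of a nonzerodivisor are nonzerodivisors, and then back to the front.
    have h1 : IsWeaklyRegular R (l ++ (x :: post)) :=
      isWeaklyRegular_of_perm_of_subset_maximalIdeal h List.perm_middle.symm hm
    have h2 := ih (fun r hr => hm r (List.perm_middle.mem_iff.1 hr)) h1
    have hmem : ∀ r ∈ l.map (· ^ q) ++ (x :: post), r ∈ maximalIdeal R := by
      intro r hr
      simp only [List.mem_append, List.mem_map, List.mem_cons] at hr
      rcases hr with ⟨a, ha, rfl⟩ | rfl | hr
      · exact Ideal.pow_mem_of_mem _ (hm a (by simp [ha])) _ (Nat.pos_of_ne_zero hq)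
      · exact hm _ (by simp)
      · exact hm r (by simp [hr])
    have h3 : IsWeaklyRegular R ((l.map (· ^ q) ++ post) ++ [x]) := by
      refine isWeaklyRegular_of_perm_of_subset_maximalIdeal h2 ?_ hmem
      rw [List.append_assoc]
      exact (List.perm_append_comm (l₁ := [x]) (l₂ := post)).append_left _
    rw [isWeaklyRegular_append_iff, isWeaklyRegular_singleton_iff] at h3
    have h4 : IsWeaklyRegular R ((l.map (· ^ q) ++ post) ++ [x ^ q]) := by
      rw [isWeaklyRegular_append_iff, isWeaklyRegular_singleton_iff]
      exact ⟨h3.1, h3.2.pow q⟩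
    refine isWeaklyRegular_of_perm_of_subset_maximalIdeal h4 ?_ ?_
    · exact List.perm_append_comm (l₂ := [x ^ q])
    · intro r hr
      rcases List.mem_append.1 hr with hr | hr
      · exact hmem r (by
          rcases List.mem_append.1 hr with hr | hr
          · exact List.mem_append_left _ hr
          · exact List.mem_append_right _ (List.mem_cons_of_mem _ hr))
      · rw [List.mem_singleton.1 hr]
        exact Ideal.pow_mem_of_mem _ (hm x (by simp)) _ (Nat.pos_of_ne_zero hq)

/-- For a regular sequence `pre, x₁, …, x_d`, an element outside `(pre, x₁^q, …, x_d^q)` has a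
multiple which is outside this ideal and congruent to `(x₁ ⋯ x_d)^{q-1} z` with
`z ∉ (pre, x₁, …, x_d)`. -/
theorem exists_mul_sub_prod_pow_mul_mem {q : ℕ} (hq : q ≠ 0) {rs : List R} :
    ∀ {pre : List R}, (∀ r ∈ pre ++ rs, r ∈ maximalIdeal R) → IsWeaklyRegular R (pre ++ rs) →
      ∀ {y : R}, y ∉ Ideal.ofList (pre ++ rs.map (· ^ q)) →
        ∃ r z : R, z ∉ Ideal.ofList (pre ++ rs) ∧
          r * y ∉ Ideal.ofList (pre ++ rs.map (· ^ q)) ∧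
          r * y - rs.prod ^ (q - 1) * z ∈ Ideal.ofList (pre ++ rs.map (· ^ q)) := by
  induction rs with
  | nil => exact fun _ _ y hy => ⟨1, y, by simpa using hy, by simpa using hy, by simp⟩
  | cons x l ih =>
    intro pre hm h y hy
    set N := Ideal.ofList (pre ++ l.map (· ^ q)) with hN
    have hperm : (pre ++ x :: l).Perm (l ++ (x :: pre)) := by
      refine List.perm_middle.trans ?_
      exact ((List.perm_append_comm (l₁ := pre) (l₂ := l)).cons x).trans List.perm_middle.symm
    -- Placing `x` last shows that it is a nonzerodivisor modulo `N`.
    have hreg : IsWeaklyRegular R ((pre ++ l.map (· ^ q)) ++ [x]) := by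
      have hm' : ∀ r ∈ l ++ (x :: pre), r ∈ maximalIdeal R := fun r hr =>
        hm r (hperm.mem_iff.2 hr)
      have h1 := isWeaklyRegular_map_pow_append hq hm'
        (isWeaklyRegular_of_perm_of_subset_maximalIdeal h hperm hm)
      refine isWeaklyRegular_of_perm_of_subset_maximalIdeal h1 ?_ ?_
      · refine List.perm_middle.trans ?_
        refine ((List.perm_append_comm (l₂ := pre)).cons x).trans ?_
        exact List.perm_append_comm (l₁ := [x])
      · intro r hr
        rcases List.mem_append.1 hr with hr | hr
        · obtain ⟨a, ha, rfl⟩ := List.mem_map.1 hr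
          exact Ideal.pow_mem_of_mem _ (hm' a (by simp [ha])) _ (Nat.pos_of_ne_zero hq)
        · exact hm' r (by simp [hr])
    have hcancel : ∀ a, x * a ∈ N → a ∈ N := fun a => mem_ofList_of_mul_mem hreg
    have hcancel' : ∀ (n : ℕ) a, x ^ n * a ∈ N → a ∈ N := by
      intro n
      induction n with
      | zero => intro a ha; simpa using ha
      | succ n ihn =>
        intro a ha
        exact hcancel a (ihn _ (by rwa [pow_succ, mul_assoc] at ha))
    have hI : Ideal.ofList (pre ++ (x :: l).map (· ^ q)) = Ideal.span {x ^ q} ⊔ N := by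
      simp only [hN, List.map_cons, Ideal.ofList_append, Ideal.ofList_cons]
      ac_rfl
    have hI' : Ideal.ofList ((pre ++ [x]) ++ l.map (· ^ q)) = Ideal.span {x} ⊔ N := by
      simp only [hN, Ideal.ofList_append, Ideal.ofList_singleton]
      ac_rfl
    rw [hI] at hy ⊢
    -- With `i + 1` the least such exponent and `q = k + 1`, cancelling one `x` gives `x ^ i * y ≡ x
    -- ^ k * w` modulo `N`. Minimality keeps `w` out of `(x) + N`, so induction applies to `w` with
    -- `x` moved into `pre`.
    have hex : ∃ j, x ^ j * y ∈ Ideal.span {x ^ q} ⊔ N :=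
      ⟨q, Ideal.mem_sup_left (Ideal.mul_mem_right _ _ (Ideal.mem_span_singleton_self _))⟩
    classical
    obtain ⟨i, hi⟩ : ∃ i, Nat.find hex = i + 1 := Nat.exists_eq_succ_of_ne_zero fun h0 => by
      have := Nat.find_spec hex
      rw [h0] at this
      exact hy (by simpa using this)
    have hi1 : x ^ (i + 1) * y ∈ Ideal.span {x ^ q} ⊔ N := hi ▸ Nat.find_spec hex
    have hi2 : x ^ i * y ∉ Ideal.span {x ^ q} ⊔ N := Nat.find_min hex (by omega)
    obtain ⟨u, hu, n, hn, hun⟩ := Submodule.mem_sup.1 hi1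
    obtain ⟨w, rfl⟩ := Ideal.mem_span_singleton'.1 hu
    obtain ⟨k, rfl⟩ := Nat.exists_eq_succ_of_ne_zero hq
    simp only [Nat.succ_eq_add_one, Nat.add_sub_cancel] at *
    have hw : x ^ i * y - x ^ k * w ∈ N := hcancel _ (by
      have : x * (x ^ i * y - x ^ k * w) = n := by linear_combination -hun
      rwa [this])
    have hpow : ∀ v ∈ Ideal.span {x} ⊔ N, x ^ k * v ∈ Ideal.span {x ^ (k + 1)} ⊔ N := by
      intro v hv
      obtain ⟨c, hc, d, hd, rfl⟩ := Submodule.mem_sup.1 hv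
      obtain ⟨c, rfl⟩ := Ideal.mem_span_singleton'.1 hc
      rw [mul_add]
      refine add_mem (Ideal.mem_sup_left (Ideal.mem_span_singleton'.2 ⟨c, by ring⟩))
        (Ideal.mem_sup_right (Ideal.mul_mem_left _ _ hd))
    have hw2 : w ∉ Ideal.ofList ((pre ++ [x]) ++ l.map (· ^ (k + 1))) := by
      rw [hI']
      intro hwm
      apply hi2
      have := add_mem (Ideal.mem_sup_right hw : _ ∈ Ideal.span {x ^ (k + 1)} ⊔ N) (hpow w hwm)
      rwa [sub_add_cancel] at this
    obtain ⟨r, z, hz, hrw, hrz⟩ := ih (pre := pre ++ [x]) (by simpa using hm) (by simpa using h) hw2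
    rw [hI'] at hrw hrz
    refine ⟨r * x ^ i, z, by simpa using hz, fun hmem => hrw ?_, ?_⟩
    -- Multiplication by `x ^ k` induces an injection from `R/((x) + N)` to `R/((x ^ (k + 1)) + N)`,
    -- so nonmembership of `r * w` is preserved.
    · have h1 : x ^ k * (r * w) ∈ Ideal.span {x ^ (k + 1)} ⊔ N := by
        have := sub_mem hmem (Ideal.mem_sup_right (Ideal.mul_mem_left _ r hw))
        have h2 : r * x ^ i * y - r * (x ^ i * y - x ^ k * w) = x ^ k * (r * w) := by ring
        rwa [h2] at this
      obtain ⟨c, hc, d, hd, hcd⟩ := Submodule.mem_sup.1 h1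
      obtain ⟨c, rfl⟩ := Ideal.mem_span_singleton'.1 hc
      have h3 : r * w - c * x ∈ N := hcancel' k _ (by
        have : x ^ k * (r * w - c * x) = d := by linear_combination -hcd
        rwa [this])
      have := add_mem (Ideal.mem_sup_right h3 : _ ∈ Ideal.span {x} ⊔ N)
        (Ideal.mem_sup_left (Ideal.mul_mem_left _ c (Ideal.mem_span_singleton_self x)))
      rwa [sub_add_cancel] at this
    · have h1 := add_mem
        (Ideal.mem_sup_right (Ideal.mul_mem_left _ r hw) : _ ∈ Ideal.span {x ^ (k + 1)} ⊔ N)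
        (hpow _ hrz)
      convert h1 using 1
      rw [List.prod_cons, mul_pow]
      ring

/-- If `x₁, …, x_d` is a regular sequence generating the maximal ideal, then the socle of
`R / (x₁^q, …, x_d^q)` is simple and contained in every nonzero ideal. -/
theorem exists_notMem_forall_exists_mul_sub_mem {q : ℕ} (hq : q ≠ 0) {rs : List R}
    (h : IsWeaklyRegular R rs) (hm : Ideal.ofList rs = maximalIdeal R) :
    ∃ s ∉ Ideal.ofList (rs.map (· ^ q)), ∀ y ∉ Ideal.ofList (rs.map (· ^ q)),
      ∃ r, r * y - s ∈ Ideal.ofList (rs.map (· ^ q)) := by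
  have hmem : ∀ r ∈ rs, r ∈ maximalIdeal R := fun r hr => hm ▸ Ideal.subset_span hr
  have key : ∀ y ∉ Ideal.ofList (rs.map (· ^ q)), _ := fun y hy =>
    exists_mul_sub_prod_pow_mul_mem (pre := []) hq hmem h hy
  simp only [List.nil_append, hm] at key
  -- In `key` the factor `z` lies outside `m`, hence is a unit that can be divided out. Taking `y =
  -- 1` there shows that the product itself is not in the ideal.
  refine ⟨rs.prod ^ (q - 1), fun hs => ?_, fun y hy => ?_⟩
  · have h1 : (1 : R) ∉ Ideal.ofList (rs.map (· ^ q)) := fun h1 => by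
      refine (maximalIdeal.isMaximal R).ne_top ((Ideal.eq_top_iff_one _).2 ?_)
      refine (Ideal.span_le.2 ?_ : Ideal.ofList (rs.map (· ^ q)) ≤ maximalIdeal R) h1
      intro r hr
      obtain ⟨a, ha, rfl⟩ := List.mem_map.1 hr
      exact Ideal.pow_mem_of_mem _ (hmem a ha) _ (Nat.pos_of_ne_zero hq)
    obtain ⟨r, z, -, hr, hrz⟩ := key 1 h1
    refine hr ?_
    have := add_mem hrz (Ideal.mul_mem_right z _ hs)
    rwa [sub_add_cancel] at this
  · obtain ⟨r, z, hz, -, hrz⟩ := key y hy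
    obtain ⟨u, rfl⟩ : IsUnit z := by simpa using hz
    refine ⟨↑u⁻¹ * r, ?_⟩
    have := Ideal.mul_mem_left _ (↑u⁻¹ : R) hrz
    have h2 : (↑u⁻¹ : R) * (r * y - rs.prod ^ (q - 1) * u) = ↑u⁻¹ * r * y - rs.prod ^ (q - 1) := by
      rw [mul_sub, mul_left_comm _ _ (u : R), Units.inv_mul]
      ring
    rwa [h2] at this

end RegularSequences

/-! ### Freeness from regular sequences -/

/-- A finite module over a Noetherian local ring is free if the maximal ideal is generated by a
sequence which is regular on the module. -/
theorem Module.Free.of_isWeaklyRegular_of_ofList_eq_maximalIdeal (n : ℕ) :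
    ∀ (R M : Type*) [CommRing R] [IsLocalRing R] [IsNoetherianRing R] [AddCommGroup M] [Module R M]
      [Module.Finite R M] (rs : List R), rs.length = n → IsWeaklyRegular M rs →
      Ideal.ofList rs = maximalIdeal R → Module.Free R M := by
  induction n with
  | zero =>
    intro R M _ _ _ _ _ _ rs hn h hm
    rw [List.length_eq_zero_iff.1 hn, Ideal.ofList_nil] at hm
    let := (isField_iff_maximalIdeal_eq.2 hm.symm).toField
    infer_instance
  | succ n ih =>
    intro R M _ _ _ _ _ _ rs hn h hm
    match rs, hn with
    | x :: l, hn =>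
      have hx : x ∈ maximalIdeal R := hm ▸ Ideal.subset_span (by simp)
      rw [isWeaklyRegular_cons_iff'] at h
      have : Nontrivial (R ⧸ Ideal.span {x}) := Ideal.Quotient.nontrivial_iff.2 fun h =>
        (maximalIdeal.isMaximal R).ne_top
          (top_le_iff.1 (h ▸ (Ideal.span_singleton_le_iff_mem _).2 hx))
      have : IsLocalRing (R ⧸ Ideal.span {x}) := .of_surjective' _ Ideal.Quotient.mk_surjective
      have := Module.Finite.of_restrictScalars_finite R (R ⧸ Ideal.span {x}) (QuotSMulTop x M)
      have := Module.finitePresentation_of_finite R M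
      -- Freeness of `M/xM` over `R/x` lifts to `M` because `x` lies in `m` and is regular on `M`.
      refine (Module.free_quotSMulTop_iff_free R M (maximalIdeal_le_jacobson _ hx) h.1).1
        (ih _ _ _ (by simpa using hn) h.2 ?_)
      rw [← Ideal.map_ofList, ← map_maximalIdeal_of_surjective _ Ideal.Quotient.mk_surjective, ← hm,
        Ideal.ofList_cons, Ideal.map_sup, sup_eq_right.2]
      rw [Ideal.map_span, Set.image_singleton, Ideal.Quotient.eq_zero_iff_mem.2
        (Ideal.mem_span_singleton_self x)]
      simp

/-! ### Duality for finite free algebras and Fedder's criterion -/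

section FreeAlgebra

variable {R S : Type*} [CommRing R] [CommRing S] [Algebra R S]

theorem LinearMap.apply_mem_of_mem_map (φ : S →ₗ[R] R) {I : Ideal R} {y : S}
    (hy : y ∈ I.map (algebraMap R S)) : φ y ∈ I := by
  -- As `φ` is only `R`-linear, the induction hypothesis must range over all multiples `t * y` with
  -- `t` in `S`.
  refine Submodule.span_induction (p := fun y _ => ∀ t : S, φ (t * y) ∈ I) ?_ (by simp) ?_ ?_ hy 1
      |> fun h => by simpa using h
  · rintro _ ⟨a, ha, rfl⟩ t
    rw [mul_comm, ← Algebra.smul_def, map_smul]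
    exact I.mul_mem_right _ ha
  · intro x y _ _ hx hy t
    rw [mul_add, map_add]
    exact add_mem (hx t) (hy t)
  · intro a x _ hx t
    rw [smul_eq_mul, ← mul_assoc]
    exact hx _

variable [Module.Free R S] [Module.Finite R S]

/-- The coordinate functionals of a basis already suffice. -/
theorem mem_map_of_forall_dual_apply_mem {I : Ideal R} {y : S} (h : ∀ φ : S →ₗ[R] R, φ y ∈ I) :
    y ∈ I.map (algebraMap R S) := by
  rw [← (Module.Free.chooseBasis R S).sum_repr y]
  refine Ideal.sum_mem _ fun i _ => ?_
  rw [Algebra.smul_def]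
  exact Ideal.mul_mem_right _ _ (Ideal.mem_map_of_mem _ (h ((Module.Free.chooseBasis R S).coord i)))

variable [IsLocalRing R]

theorem exists_dual_apply_eq_one {y : S} (hy : y ∉ (maximalIdeal R).map (algebraMap R S)) :
    ∃ φ : S →ₗ[R] R, φ y = 1 := by
  have : ∃ φ : S →ₗ[R] R, φ y ∉ maximalIdeal R := by
    by_contra! h
    exact hy (mem_map_of_forall_dual_apply_mem h)
  obtain ⟨φ, hφ⟩ := this
  obtain ⟨u, hu⟩ : IsUnit (φ y) := by simpa using hφ
  exact ⟨(↑u⁻¹ : R) • φ, by simp [← hu]⟩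

/-- If the closed fibre of a finite free algebra `S` over a local ring has a simple socle that is
contained in every nonzero ideal, then `Hom_R(S, R)` is a cyclic `S`-module. -/
theorem exists_dual_forall_exists_eq_apply_mul {s : S}
    (hs : s ∉ (maximalIdeal R).map (algebraMap R S))
    (hsoc : ∀ y ∉ (maximalIdeal R).map (algebraMap R S),
      ∃ r, r * y - s ∈ (maximalIdeal R).map (algebraMap R S)) :
    ∃ Φ : S →ₗ[R] R, ∀ φ : S →ₗ[R] R, ∃ a : S, ∀ x, φ x = Φ (a * x) := by
  classical
  obtain ⟨Φ, hΦ⟩ := exists_dual_apply_eq_one hs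
  refine ⟨Φ, ?_⟩
  let b := Module.Free.chooseBasis R S
  -- The Gram matrix of the form `(x, y) ↦ Φ(xy)`: representing every functional as `Φ(a ·)` amounts
  -- to its invertibility.
  let G : Matrix _ _ R := Matrix.of fun i j => Φ (b i * b j)
  have hmul : ∀ (w : _ → R) i, G.mulVec w i = Φ (b i * ∑ j, w j • b j) := by
    intro w i
    rw [Matrix.mulVec, dotProduct, Finset.mul_sum, map_sum]
    refine Finset.sum_congr rfl fun j _ => ?_
    rw [mul_smul_comm, map_smul, smul_eq_mul, mul_comm]
    rfl
  have hdet : IsUnit G.det := by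
    -- A null vector of `G` modulo `m` lifts to some `y ∉ mS` with `Φ(Sy) ⊆ m`. But `s ∈ Sy + mS`
    -- and `Φ(s) = 1`.
    by_contra hG
    have h0 : (G.map (residue R)).det = 0 := by
      have := RingHom.map_det (residue R) G
      rw [RingHom.mapMatrix_apply] at this
      rw [← this, residue_eq_zero_iff]
      exact hG
    obtain ⟨v, hv0, hv⟩ := Matrix.exists_mulVec_eq_zero_iff.2 h0
    choose w hw using fun i => residue_surjective (R := R) (v i)
    set y := ∑ j, w j • b j with hy
    have hyi : ∀ i, Φ (b i * y) ∈ maximalIdeal R := by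
      intro i
      rw [← hmul, ← residue_eq_zero_iff, RingHom.map_mulVec]
      have : residue R ∘ w = v := funext hw
      rw [this, hv, Pi.zero_apply]
    have hyall : ∀ r, Φ (r * y) ∈ maximalIdeal R := by
      intro r
      rw [← b.sum_repr r, Finset.sum_mul, map_sum]
      refine Ideal.sum_mem _ fun i _ => ?_
      rw [smul_mul_assoc, map_smul]
      exact Ideal.mul_mem_left _ _ (hyi i)
    have hym : y ∉ (maximalIdeal R).map (algebraMap R S) := by
      intro hmem
      apply hv0
      funext i
      rw [← hw i, Pi.zero_apply, residue_eq_zero_iff]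
      have := (b.coord i).apply_mem_of_mem_map hmem
      rwa [hy, Module.Basis.coord_apply, b.repr_sum_self] at this
    obtain ⟨r, hr⟩ := hsoc y hym
    have h1 := sub_mem (hyall r) (Φ.apply_mem_of_mem_map hr)
    rw [map_sub, hΦ, sub_sub_cancel] at h1
    exact (Ideal.ne_top_iff_one _).1 (maximalIdeal.isMaximal R).ne_top h1
  intro φ
  let w := G⁻¹.mulVec fun i => φ (b i)
  refine ⟨∑ j, w j • b j, fun x => ?_⟩
  have h1 : φ = Φ ∘ₗ LinearMap.mulLeft R (∑ j, w j • b j) := by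
    refine b.ext fun i => ?_
    rw [LinearMap.comp_apply, LinearMap.mulLeft_apply, mul_comm, ← hmul w i, Matrix.mulVec_mulVec,
      Matrix.mul_nonsing_inv _ hdet, Matrix.one_mulVec]
  rw [h1]
  rfl

/-- **Fedder's criterion** for a finite free algebra whose closed fibre is Gorenstein. -/
theorem exists_dual_map_le_apply_notMem_iff {s : S}
    (hs : s ∉ (maximalIdeal R).map (algebraMap R S))
    (hsoc : ∀ y ∉ (maximalIdeal R).map (algebraMap R S),
      ∃ r, r * y - s ∈ (maximalIdeal R).map (algebraMap R S)) (I : Ideal R) (K : Ideal S) (h : S) :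
    (∃ φ : S →ₗ[R] R, (∀ x ∈ K, φ x ∈ I) ∧ φ h ∉ maximalIdeal R) ↔
      ¬ Ideal.span {h} * (I.map (algebraMap R S)).colon (K : Set S) ≤
        (maximalIdeal R).map (algebraMap R S) := by
  constructor
  · rintro ⟨φ, hφK, hφh⟩ hle
    obtain ⟨Φ, hΦ⟩ := exists_dual_forall_exists_eq_apply_mul hs hsoc
    obtain ⟨a, ha⟩ := hΦ φ
    apply hφh
    rw [ha, mul_comm]
    refine Φ.apply_mem_of_mem_map (hle ?_)
    refine Ideal.mul_mem_mul (Ideal.mem_span_singleton_self h) ?_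
    -- Membership of `a * x` in `IS` is tested by functionals `ψ = Φ(c ·)`, and `ψ(ax) = φ(cx)` lies
    -- in `I` because `cx ∈ K`.
    refine Submodule.mem_colon.2 fun x hx => mem_map_of_forall_dual_apply_mem fun ψ => ?_
    obtain ⟨c, hc⟩ := hΦ ψ
    rw [hc, smul_eq_mul, mul_left_comm, ← ha]
    exact hφK _ (K.mul_mem_left c hx)
  · intro hle
    obtain ⟨y, hy, hym⟩ := SetLike.not_le_iff_exists.1 hle
    obtain ⟨a, ha, rfl⟩ := Ideal.mem_span_singleton_mul.1 hy
    obtain ⟨ψ, hψ⟩ := exists_dual_apply_eq_one hym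
    refine ⟨ψ ∘ₗ LinearMap.mulLeft R a, fun x hx => ψ.apply_mem_of_mem_map ?_, ?_⟩
    · exact Submodule.mem_colon.1 ha x hx
    · rw [LinearMap.comp_apply, LinearMap.mulLeft_apply, mul_comm, hψ]
      exact (Ideal.ne_top_iff_one _).1 (maximalIdeal.isMaximal R).ne_top

end FreeAlgebra

namespace FPairs

/-! ### Sections of divisors on normal affine schemes -/

section Divisors

variable {A : Type*} [CommRing A] [IsDomain A] [IsNoetherianRing A] [IsIntegrallyClosed A]

theorem PrimeDivisor.ord_mul (P : PrimeDivisor A) {f g : FractionRing A} (hf : f ≠ 0)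
    (hg : g ≠ 0) : P.ord (f * g) = P.ord f + P.ord g := by
  have hf' : P.valuation f ≠ 0 := (Valuation.ne_zero_iff _).2 hf
  have hg' : P.valuation g ≠ 0 := (Valuation.ne_zero_iff _).2 hg
  simp only [PrimeDivisor.ord]
  rw [map_mul, WithZero.log_mul hf' hg']
  ring

theorem PrimeDivisor.ord_pow (P : PrimeDivisor A) (f : FractionRing A) (n : ℕ) :
    P.ord (f ^ n) = n * P.ord f := by
  simp only [PrimeDivisor.ord]
  rw [map_pow, WithZero.log_pow]
  simp

theorem PrimeDivisor.ord_algebraMap_pos (P : PrimeDivisor A) {a : A} (ha0 : a ≠ 0)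
    (ha : a ∈ P.1.asIdeal) : 0 < P.ord (algebraMap A (FractionRing A) a) := by
  have h1 : P.valuation (algebraMap A (FractionRing A) a) < 1 := by
    rw [IsScalarTower.algebraMap_apply A P.LocalRing (FractionRing A)]
    refine (IsDedekindDomain.HeightOneSpectrum.valuation_lt_one_iff_mem _ _).2 ?_
    exact (IsLocalization.AtPrime.to_map_mem_maximal_iff P.LocalRing P.1.asIdeal a).2 ha
  have h0 : P.valuation (algebraMap A (FractionRing A) a) ≠ 0 := by simpa using ha0
  have := (WithZero.log_lt_log h0 one_ne_zero).2 h1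
  simp only [WithZero.log_one] at this
  simp only [PrimeDivisor.ord]
  omega

/-- A rational function on a normal Noetherian affine scheme which is regular in codimension one
is regular. -/
theorem exists_algebraMap_eq_of_forall_ord_nonneg {f : FractionRing A}
    (hf : ∀ P : PrimeDivisor A, 0 ≤ P.ord f) : ∃ a : A, algebraMap A (FractionRing A) a = f := by
  by_contra hfA
  let N : Submodule A (FractionRing A) := LinearMap.range (Algebra.linearMap A (FractionRing A))
  have hN : ∀ y, y ∈ N ↔ ∃ a : A, algebraMap A (FractionRing A) a = y := fun y => Iff.rfl
  let M : Submodule A (FractionRing A ⧸ N) := Submodule.span A {N.mkQ f}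
  have hfM : (⟨N.mkQ f, Submodule.mem_span_singleton_self _⟩ : M) ≠ 0 := by
    intro h
    have := congrArg Subtype.val h
    exact hfA ((hN f).1 ((Submodule.Quotient.mk_eq_zero N).1 this))
  -- An associated prime of the submodule of `L/A` generated by `f` has the form `P = {s | s y ∈ A}`
  -- for some multiple `y = r f` outside `A`.
  obtain ⟨P, hP, -⟩ := exists_le_isAssociatedPrime_of_isNoetherianRing A _ hfM
  obtain ⟨hPprime, ⟨m, hm⟩, hPm⟩ := (isAssociatedPrime_iff).1 hP
  obtain ⟨r, rfl⟩ := Submodule.mem_span_singleton.1 hm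
  set y := r • f with hy
  have hPy : ∀ s : A, s ∈ P ↔ ∃ a : A, algebraMap A (FractionRing A) a = s • y := by
    intro s
    rw [hPm, Submodule.mem_colon_singleton, Submodule.mem_bot, ← hN,
      ← Submodule.Quotient.mk_eq_zero N, ← Subtype.coe_inj]
    rfl
  have hyA : ¬ ∃ a : A, algebraMap A (FractionRing A) a = y := by
    have := (Ideal.ne_top_iff_one _).1 hPprime.ne_top
    rwa [hPy, one_smul] at this
  have hf0 : f ≠ 0 := by
    rintro rfl
    exact hfA ⟨0, map_zero _⟩
  have hr0 : r ≠ 0 := by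
    rintro rfl
    exact hyA ⟨0, by simp [hy]⟩
  have hinj := IsFractionRing.injective A (FractionRing A)
  -- If `yP ⊆ P`, then `y` is integral by the determinant trick, hence in `A`. Otherwise `s y = u ∉
  -- P` for some `s ∈ P`; then `P` has height one and `0 = ord u = ord s + ord r + ord f > 0`.
  by_cases hcase : ∀ s ∈ P, ∀ a : A, algebraMap A (FractionRing A) a = s • y → a ∈ P
  · have hPbot : P ≠ ⊥ := by
      rintro hbot
      obtain ⟨a, b, hb, hab⟩ := IsFractionRing.div_surjective A y
      have hb0 : b ≠ 0 := nonZeroDivisors.ne_zero hb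
      have : b ∈ P := (hPy b).2 ⟨a, by
        rw [← hab, Algebra.smul_def, mul_div_cancel₀]
        exact (map_ne_zero_iff _ hinj).2 hb0⟩
      rw [hbot] at this
      exact hb0 this
    have hint : IsIntegral A y := by
      refine isIntegral_of_smul_mem_submodule
        (Submodule.map (Algebra.linearMap A (FractionRing A)) P) ?_
        (Submodule.FG.map _ P.fg_of_isNoetherianRing) y ?_
      · intro h
        refine hPbot (Submodule.map_injective_of_injective
          (f := Algebra.linearMap A (FractionRing A)) hinj ?_)
        rw [h, Submodule.map_bot]
      · rintro _ ⟨s, hs, rfl⟩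
        obtain ⟨a, ha⟩ := (hPy s).1 hs
        refine ⟨a, hcase s hs a ha, ?_⟩
        rw [Algebra.linearMap_apply, ha, Algebra.linearMap_apply, smul_eq_mul, mul_comm,
          Algebra.smul_def]
    exact hyA (IsIntegrallyClosed.isIntegral_iff.1 hint)
  · push Not at hcase
    obtain ⟨s, hs, u, hu, huP⟩ := hcase
    have hs0 : s ≠ 0 := by
      rintro rfl
      rw [zero_smul, map_eq_zero_iff _ hinj] at hu
      exact huP (hu ▸ P.zero_mem)
    have hmin : P ∈ (Ideal.span {s}).minimalPrimes := by
      refine ⟨⟨hPprime, (Ideal.span_singleton_le_iff_mem _).2 hs⟩, ?_⟩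
      -- For `s' ∈ P` put `a = s' y ∈ A`. Then `u s' = s a ∈ Q` with `u ∉ Q`, so `s' ∈ Q`.
      rintro Q ⟨hQ, hsQ⟩ hQP s' hs'
      obtain ⟨a, ha⟩ := (hPy s').1 hs'
      have h1 : u * s' = s * a := by
        apply hinj
        rw [map_mul, map_mul, hu, ha, Algebra.smul_def, Algebra.smul_def]
        ring
      have h2 : u * s' ∈ Q := h1 ▸ Q.mul_mem_right _ ((Ideal.span_singleton_le_iff_mem _).1 hsQ)
      exact (hQ.mem_or_mem h2).resolve_left fun h => huP (hQP h)
    have hheight : P.height = 1 := by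
      refine le_antisymm (Ideal.height_le_one_of_isPrincipal_of_mem_minimalPrimes _ P hmin) ?_
      refine (Ideal.one_le_height_span_singleton_of_mem_nonZeroDivisors
        (mem_nonZeroDivisors_of_ne_zero hs0)).trans (Ideal.height_mono hmin.1.2)
    let D : PrimeDivisor A := ⟨⟨P, hPprime⟩, hheight⟩
    have hs0' : algebraMap A (FractionRing A) s ≠ 0 := (map_ne_zero_iff _ hinj).2 hs0
    have hr0' : algebraMap A (FractionRing A) r ≠ 0 := (map_ne_zero_iff _ hinj).2 hr0
    have h1 := D.ord_algebraMap_of_notMem huP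
    have h2 := D.ord_algebraMap_pos hs0 hs
    have h3 := D.ord_algebraMap_nonneg r
    have h4 := hf D
    rw [hu, hy, Algebra.smul_def, Algebra.smul_def, D.ord_mul hs0' (mul_ne_zero hr0' hf0),
      D.ord_mul hr0' hf0] at h1
    omega

theorem div_apply (f : FractionRing A) (P : PrimeDivisor A) : div f P = P.ord f := rfl

theorem mem_sections_iff (D : QDivisor A) {f : FractionRing A} :
    f ∈ sections D ↔ f = 0 ∨ ∀ P, (0 : ℚ) ≤ P.ord f + D P := Iff.rfl

/-- `A(s div(g)) = g^{-⌊s⌋} A` if `div(g)` is reduced. -/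
theorem mem_sections_smul_div_iff {g : A} (hg : g ≠ 0)
    (hred : (div (algebraMap A (FractionRing A) g)).IsReduced) {s : ℚ} (hs : 0 ≤ s)
    {f : FractionRing A} : f ∈ sections (s • div (algebraMap A (FractionRing A) g)) ↔
      ∃ a : A, algebraMap A (FractionRing A) a = f * algebraMap A (FractionRing A) g ^ ⌊s⌋₊ := by
  have hg0 : algebraMap A (FractionRing A) g ≠ 0 :=
    (map_ne_zero_iff _ (IsFractionRing.injective A _)).2 hg
  have hfl : ((⌊s⌋₊ : ℤ) : ℚ) ≤ s := by exact_mod_cast Nat.floor_le hs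
  by_cases hf : f = 0
  · subst hf
    exact iff_of_true (Submodule.zero_mem _) ⟨0, by simp⟩
  have hord : ∀ P : PrimeDivisor A, P.ord (f * algebraMap A (FractionRing A) g ^ ⌊s⌋₊)
      = P.ord f + ⌊s⌋₊ * P.ord (algebraMap A (FractionRing A) g) := fun P => by
    rw [P.ord_mul hf (pow_ne_zero _ hg0), P.ord_pow]
  rw [mem_sections_iff]
  simp only [hf, false_or, Finsupp.smul_apply, div_apply, smul_eq_mul]
  constructor
  · intro h
    apply exists_algebraMap_eq_of_forall_ord_nonneg
    intro P
    rw [hord]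
    have hP := h P
    by_cases hP0 : P.ord (algebraMap A (FractionRing A) g) = 0
    · rw [hP0] at hP ⊢
      simp only [Int.cast_zero, mul_zero, add_zero] at hP ⊢
      exact_mod_cast hP
    · have h1 : (P.ord (algebraMap A (FractionRing A) g) : ℚ) = 1 :=
        hred P (Finsupp.mem_support_iff.2 (by rw [div_apply]; exact_mod_cast hP0))
      rw [h1] at hP
      have h1' : P.ord (algebraMap A (FractionRing A) g) = 1 := by exact_mod_cast h1
      rw [h1']
      -- Since `ord f` is an integer and the coefficient of `P` is one, the bound by `s` improves to
      -- a bound by `⌊s⌋`.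
      have h2 : -P.ord f ≤ ⌊s⌋ := Int.le_floor.2 (by push_cast; linarith)
      rw [← Int.natCast_floor_eq_floor hs] at h2
      omega
  · rintro ⟨a, ha⟩ P
    have h1 := P.ord_algebraMap_nonneg a
    rw [ha, hord] at h1
    have h2 : (0 : ℚ) ≤ P.ord (algebraMap A (FractionRing A) g) := by
      exact_mod_cast P.ord_algebraMap_nonneg g
    have h3 : (0 : ℚ) ≤ P.ord f + ((⌊s⌋₊ : ℤ) : ℚ) * P.ord (algebraMap A (FractionRing A) g) := by
      exact_mod_cast h1
    nlinarith [mul_le_mul_of_nonneg_right hfl h2]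

/-- A principal divisor has integral coefficients, so rounding changes nothing, and `a / g` lies in
`A` as soon as all its orders are nonnegative. -/
theorem roundDownIdeal_div {g : A} (hg : g ≠ 0) :
    roundDownIdeal (div (algebraMap A (FractionRing A) g)) = Ideal.span {g} := by
  have hg0 : algebraMap A (FractionRing A) g ≠ 0 :=
    (map_ne_zero_iff _ (IsFractionRing.injective A _)).2 hg
  ext a
  rw [Ideal.mem_span_singleton', roundDownIdeal, Submodule.mem_comap, mem_sections_iff]
  simp only [Algebra.linearMap_apply, Finsupp.neg_apply, QDivisor.roundDown, Finsupp.mapRange_apply,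
    div_apply, Int.floor_intCast]
  by_cases ha : a = 0
  · subst ha
    exact iff_of_true (Or.inl (map_zero _)) ⟨0, by simp⟩
  have ha0 : algebraMap A (FractionRing A) a ≠ 0 :=
    (map_ne_zero_iff _ (IsFractionRing.injective A _)).2 ha
  simp only [ha0, false_or]
  constructor
  · intro h
    obtain ⟨b, hb⟩ := exists_algebraMap_eq_of_forall_ord_nonneg
      (f := algebraMap A (FractionRing A) a / algebraMap A (FractionRing A) g) fun P => by
        have h1 := P.ord_mul (div_ne_zero ha0 hg0) hg0
        rw [div_mul_cancel₀ _ hg0] at h1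
        have h2 : (0 : ℤ) ≤ P.ord (algebraMap A (FractionRing A) a) +
            -P.ord (algebraMap A (FractionRing A) g) := by exact_mod_cast h P
        omega
    refine ⟨b, IsFractionRing.injective A (FractionRing A) ?_⟩
    rw [map_mul, hb, div_mul_cancel₀ _ hg0]
  · rintro ⟨b, rfl⟩ P
    have hb : b ≠ 0 := left_ne_zero_of_mul ha
    have hb0 : algebraMap A (FractionRing A) b ≠ 0 :=
      (map_ne_zero_iff _ (IsFractionRing.injective A _)).2 hb
    rw [map_mul, P.ord_mul hb0 hg0]
    have := P.ord_algebraMap_nonneg b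
    push_cast
    rw [add_neg_cancel_right]
    exact_mod_cast this

end Divisors

/-! ### Absorbing the divisor into the element to be split -/

section Pairs

/-- The map `M^{1/q} → N^{1/q}` induced by a linear map `M → N`. -/
def Root.map {A : Type*} [CommRing A] (p e : ℕ) [ExpChar A p] {M N : Type*} [AddCommGroup M]
    [Module A M] [AddCommGroup N] [Module A N] (l : M →ₗ[A] N) : Root A p e M →ₗ[A] Root A p e N where
  toFun x := Root.mk A p e (l x)
  map_add' := l.map_add
  map_smul' a := l.map_smul (iterateFrobenius A p e a)

theorem Root.map_mk {A : Type*} [CommRing A] (p e : ℕ) [ExpChar A p] {M N : Type*} [AddCommGroup M]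
    [Module A M] [AddCommGroup N] [Module A N] (l : M →ₗ[A] N) (x : M) :
    Root.map p e l (Root.mk A p e x) = Root.mk A p e (l x) := rfl

variable {A : Type*} [CommRing A] [IsDomain A] [IsNoetherianRing A] [IsIntegrallyClosed A]
  (p : ℕ) [Fact p.Prime] [CharP A p]

/-- Multiplication by `g^{⌊s⌋}` identifies `A(s div(g))^{1/q}` with `A^{1/q}`, so that the
splitting of `c^{1/q} A → A(s div(g))^{1/q}` becomes that of `(c g^{⌊s⌋})^{1/q} A → A^{1/q}`. -/
theorem splits_smul_div_iff (e : ℕ) {g : A} (hg : g ≠ 0)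
    (hred : (div (algebraMap A (FractionRing A) g)).IsReduced) {s : ℚ} (hs : 0 ≤ s) (c : A)
    (hD : 0 ≤ s • div (algebraMap A (FractionRing A) g)) :
    Splits p e (s • div (algebraMap A (FractionRing A) g)) hD c ↔
      ∃ ψ : Root A p e A →ₗ[A] A, ψ (Root.mk A p e (c * g ^ ⌊s⌋₊)) = 1 := by
  set D := s • div (algebraMap A (FractionRing A) g) with hDdef
  have hinj := IsFractionRing.injective A (FractionRing A)
  have hg0 : algebraMap A (FractionRing A) g ≠ 0 := (map_ne_zero_iff _ hinj).2 hg
  have hmem : ∀ {f : FractionRing A}, f ∈ sections D ↔ ∃ a : A,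
      algebraMap A (FractionRing A) a = f * algebraMap A (FractionRing A) g ^ ⌊s⌋₊ :=
    mem_sections_smul_div_iff hg hred hs
  have hG : algebraMap A (FractionRing A) g ^ ⌊s⌋₊ ≠ 0 := pow_ne_zero _ hg0
  let β : A →ₗ[A] sections D :=
    (LinearMap.toSpanSingleton A (FractionRing A)
      (algebraMap A (FractionRing A) g ^ ⌊s⌋₊)⁻¹).codRestrict (sections D) fun a => hmem.2 ⟨a, by
        rw [LinearMap.toSpanSingleton_apply, Algebra.smul_def, inv_mul_cancel_right₀ hG]⟩
  have hβ : ∀ a, (β a : FractionRing A) =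
      algebraMap A (FractionRing A) a * (algebraMap A (FractionRing A) g ^ ⌊s⌋₊)⁻¹ := fun a =>
    Algebra.smul_def _ _
  have hβbij : Function.Bijective β := by
    refine ⟨fun a b hab => hinj ?_, fun f => ?_⟩
    · have := congrArg Subtype.val hab
      rwa [hβ, hβ, mul_left_inj' (inv_ne_zero hG)] at this
    · obtain ⟨a, ha⟩ := hmem.1 f.2
      exact ⟨a, Subtype.ext (by rw [hβ, ha, mul_inv_cancel_right₀ hG])⟩
  let ε : A ≃ₗ[A] sections D := LinearEquiv.ofBijective β hβbij
  have hε : ε (c * g ^ ⌊s⌋₊) = ⟨algebraMap A (FractionRing A) c, algebraMap_mem_sections hD c⟩ :=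
    Subtype.ext ((hβ _).trans (by rw [map_mul, map_pow, mul_inv_cancel_right₀ hG]))
  constructor
  · rintro ⟨φ, hφ⟩
    refine ⟨φ ∘ₗ Root.map p e ε.toLinearMap, ?_⟩
    have := LinearMap.congr_fun hφ 1
    simp only [rootMap, LinearMap.comp_apply, LinearMap.toSpanSingleton_apply, one_smul,
      LinearMap.id_apply] at this
    rw [LinearMap.comp_apply, Root.map_mk, LinearEquiv.coe_coe, hε, this]
  · rintro ⟨ψ, hψ⟩
    refine ⟨ψ ∘ₗ Root.map p e ε.symm.toLinearMap, LinearMap.ext_ring ?_⟩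
    simp only [rootMap, LinearMap.comp_apply, LinearMap.toSpanSingleton_apply, one_smul,
      LinearMap.id_apply]
    rw [Root.map_mk, ← hε, LinearEquiv.coe_coe, ε.symm_apply_apply, hψ]

end Pairs

end FPairs

namespace FPairs

/-! ### The algebra `R^{1/q}` and Fedder's criterion for `R / I` -/

section FrobeniusRoot

variable (R : Type*) [CommRing R] (p e : ℕ)

set_option linter.unusedVariables false in
/-- The ring `R^{1/q}`, `q = p ^ e`, viewed as `R` with the `R`-algebra structure given by the
iterated Frobenius endomorphism. -/
def FrobeniusRoot (R : Type*) (p e : ℕ) : Type _ := R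

instance : CommRing (FrobeniusRoot R p e) := inferInstanceAs (CommRing R)

variable [ExpChar R p]

noncomputable instance : Algebra R (FrobeniusRoot R p e) :=
  (iterateFrobenius R p e : R →+* R).toAlgebra

theorem FrobeniusRoot.map_ofList (rs : List R) :
    (Ideal.ofList rs).map (algebraMap R (FrobeniusRoot R p e)) =
      (Ideal.ofList (rs.map (· ^ p ^ e)) : Ideal R) :=
  Ideal.map_ofList (algebraMap R (FrobeniusRoot R p e)) rs

theorem FrobeniusRoot.finite (hF : (frobenius R p).Finite) :
    Module.Finite R (FrobeniusRoot R p e) := by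
  suffices h : (iterateFrobenius R p e : R →+* R).Finite from h
  induction e with
  | zero =>
    rw [iterateFrobenius_zero]
    exact RingHom.Finite.id R
  | succ n ih =>
    have : iterateFrobenius R p (n + 1) = (frobenius R p).comp (iterateFrobenius R p n) := by
      ext x
      simp [iterateFrobenius_def, frobenius_def, pow_succ, pow_mul]
    rw [this]
    exact hF.comp ih

end FrobeniusRoot

variable {R : Type*} [CommRing R] [IsRegularLocalRing R] (p : ℕ) [Fact p.Prime] [CharP R p]

/-- An easy case of **Kunz's theorem**: over an F-finite regular local ring, `R^{1/q}` is free. -/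
theorem FrobeniusRoot.free (e : ℕ) (hF : IsFFinite R p) :
    Module.Free R (FrobeniusRoot R p e) := by
  obtain ⟨rs, hrs, hm⟩ := IsRegularLocalRing.exists_isWeaklyRegular R
  have hq : p ^ e ≠ 0 := pow_ne_zero _ (Fact.out : p.Prime).ne_zero
  have := FrobeniusRoot.finite R p e hF
  refine Module.Free.of_isWeaklyRegular_of_ofList_eq_maximalIdeal _ R _ rs rfl ?_ hm
  -- The elements of `rs` act on `R^{1/q}` through their `q`-th powers on `R`.
  have h1 : IsWeaklyRegular R (rs.map (· ^ p ^ e)) := by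
    simpa using isWeaklyRegular_map_pow_append hq (post := [])
      (fun r hr => hm ▸ Ideal.subset_span (by simpa using hr)) (by simpa using hrs)
  exact (isWeaklyRegular_map_algebraMap_iff (R := R) (S := FrobeniusRoot R p e)
    (FrobeniusRoot R p e) rs).1 h1

/-- Fedder's criterion in terms of `R`-linear maps `R^{1/q} → R`. -/
theorem exists_dual_frobeniusRoot_iff (e : ℕ) (hF : IsFFinite R p) (I : Ideal R) (h : R) :
    (∃ φ : FrobeniusRoot R p e →ₗ[R] R, (∀ x : R, x ∈ I → φ x ∈ I) ∧
        φ (show R from h) ∉ maximalIdeal R) ↔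
      ¬ Ideal.span {h} * (frobeniusPower I (p ^ e)).colon (I : Set R) ≤
        frobeniusPower (maximalIdeal R) (p ^ e) := by
  obtain ⟨rs, hrs, hm⟩ := IsRegularLocalRing.exists_isWeaklyRegular R
  have hq : p ^ e ≠ 0 := pow_ne_zero _ (Fact.out : p.Prime).ne_zero
  have := FrobeniusRoot.finite R p e hF
  have := FrobeniusRoot.free p e hF
  obtain ⟨s, hs, hsoc⟩ := exists_notMem_forall_exists_mul_sub_mem hq hrs hm
  have hmap := FrobeniusRoot.map_ofList R p e rs
  rw [hm] at hmap
  let K : Ideal (FrobeniusRoot R p e) := I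
  let s' : FrobeniusRoot R p e := s
  -- `frobeniusPower J (p ^ e)` unfolds to the extension of `J` along the iterated Frobenius, so the
  -- general criterion applies as it stands.
  exact exists_dual_map_le_apply_notMem_iff (s := s') (fun h => hs (hmap.le h))
    (fun y hy => (hsoc y fun h => hy (hmap.ge h)).imp fun r hr => hmap.ge hr) I K h

/-- **Fedder's criterion**: the splitting of `h^{1/q} A → A^{1/q}` for `A = R / I`. -/
theorem exists_root_linearMap_eq_one_iff (e : ℕ) (hF : IsFFinite R p) (I : Ideal R) [I.IsPrime]
    (h : R) :
    (∃ ψ : Root (R ⧸ I) p e (R ⧸ I) →ₗ[R ⧸ I] R ⧸ I,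
        ψ (Root.mk (R ⧸ I) p e (Ideal.Quotient.mk I h)) = 1) ↔
      ¬ Ideal.span {h} * (frobeniusPower I (p ^ e)).colon (I : Set R) ≤
        frobeniusPower (maximalIdeal R) (p ^ e) := by
  rw [← exists_dual_frobeniusRoot_iff p e hF]
  have hI : I ≤ maximalIdeal R := le_maximalIdeal (Ideal.IsPrime.ne_top ‹_›)
  constructor
  · rintro ⟨ψ, hψ⟩
    have := FrobeniusRoot.free p e hF
    let ψ' : FrobeniusRoot R p e →ₗ[R] R ⧸ I :=
      { toFun := fun x => ψ (Root.mk (R ⧸ I) p e (Ideal.Quotient.mk I x))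
        map_add' := fun x y => by
          rw [← map_add]
          exact congrArg ψ (map_add (Ideal.Quotient.mk I) x y)
        map_smul' := fun a x => by
          have h1 : Root.mk (R ⧸ I) p e (Ideal.Quotient.mk I (a • x : FrobeniusRoot R p e)) =
              Ideal.Quotient.mk I a • Root.mk (R ⧸ I) p e (Ideal.Quotient.mk I x) := by
            rw [Root.smul_mk, ← map_pow]
            exact map_mul (Ideal.Quotient.mk I) _ _
          rw [h1, map_smul]
          rfl }
    -- The lift exists because `R^{1/q}` is free. It preserves `I` because `ψ'` vanishes on `I`.
    obtain ⟨φ, hφ⟩ := Module.projective_lifting_property I.mkQ ψ' I.mkQ_surjective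
    have hφ' : ∀ x : R, Ideal.Quotient.mk I (φ x) =
        ψ (Root.mk (R ⧸ I) p e (Ideal.Quotient.mk I x)) := fun x => LinearMap.congr_fun hφ x
    refine ⟨φ, fun x hx => ?_, fun hmem => ?_⟩
    · rw [← Ideal.Quotient.eq_zero_iff_mem, hφ', Ideal.Quotient.eq_zero_iff_mem.2 hx]
      exact map_zero ψ
    · have h1 : 1 - φ (show R from h) ∈ I := by
        rw [← Ideal.Quotient.eq_zero_iff_mem, map_sub, hφ', hψ, map_one, sub_self]
      have h2 := add_mem (hI h1) hmem
      rw [sub_add_cancel] at h2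
      exact (Ideal.ne_top_iff_one _).1 (maximalIdeal.isMaximal R).ne_top h2
  · rintro ⟨φ, hφI, hφh⟩
    obtain ⟨u, hu⟩ : IsUnit (φ (show R from h)) := by simpa using hφh
    let φ₀ : R →+ R ⧸ I := ((Ideal.Quotient.mk I : R →+* R ⧸ I) : R →+ R ⧸ I).comp
      (φ.toAddMonoidHom : R →+ R)
    -- The descent is made additively first, since the `A`-action on the source is twisted by
    -- Frobenius; linearity is checked afterwards on representatives.
    let φ₁ : R ⧸ I →+ R ⧸ I := QuotientAddGroup.lift I.toAddSubgroup φ₀ fun x hx =>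
      Ideal.Quotient.eq_zero_iff_mem.2 (hφI x hx)
    have hφ₁ : ∀ x : R, φ₁ (Ideal.Quotient.mk I x) = Ideal.Quotient.mk I (φ x) := fun x => rfl
    let φ₂ : Root (R ⧸ I) p e (R ⧸ I) →ₗ[R ⧸ I] R ⧸ I :=
      { toFun := fun x => φ₁ x
        map_add' := φ₁.map_add
        map_smul' := fun a x => by
          obtain ⟨a, rfl⟩ := Ideal.Quotient.mk_surjective a
          obtain ⟨x, rfl⟩ := Ideal.Quotient.mk_surjective (I := I) x
          have h1 : (Ideal.Quotient.mk I a • (Root.mk (R ⧸ I) p e (Ideal.Quotient.mk I x))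
              : Root (R ⧸ I) p e (R ⧸ I)) =
              (Ideal.Quotient.mk I (a • (show FrobeniusRoot R p e from x)) : R ⧸ I) := by
            rw [Root.smul_mk, ← map_pow]
            exact (map_mul (Ideal.Quotient.mk I) _ _).symm
          refine (congrArg φ₁ h1).trans ?_
          exact (congrArg (Ideal.Quotient.mk I) (φ.map_smul a x)).trans
            (map_mul (Ideal.Quotient.mk I) _ _) }
    refine ⟨Ideal.Quotient.mk I (↑u⁻¹ : R) • φ₂, ?_⟩
    change Ideal.Quotient.mk I (↑u⁻¹ : R) * φ₁ (Ideal.Quotient.mk I h) = 1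
    rw [hφ₁]
    change _ * Ideal.Quotient.mk I (φ (show R from h)) = 1
    rw [← hu, ← map_mul, Units.inv_mul, map_one]

/-- The splitting condition for the pair `(R / I, s div(ḡ))` in terms of ideals of `R`. -/
theorem splits_smul_divMk_iff (e : ℕ) (hF : IsFFinite R p) (I : Ideal R) [I.IsPrime]
    [IsIntegrallyClosed (R ⧸ I)] {g : R} (hg : g ∉ I) (hred : (divMk I g).IsReduced) {s : ℚ}
    (hs : 0 ≤ s) (c : R) {D : QDivisor (R ⧸ I)} (hD : 0 ≤ D) (hDs : D = s • divMk I g) :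
    Splits p e D hD (Ideal.Quotient.mk I c) ↔
      ¬ Ideal.span {c * g ^ ⌊s⌋₊} * (frobeniusPower I (p ^ e)).colon (I : Set R) ≤
        frobeniusPower (maximalIdeal R) (p ^ e) := by
  subst hDs
  have hg0 : Ideal.Quotient.mk I g ≠ 0 := fun h => hg (Ideal.Quotient.eq_zero_iff_mem.1 h)
  rw [← exists_root_linearMap_eq_one_iff p e hF, map_mul, map_pow]
  exact splits_smul_div_iff p e hg0 hred hs _ hD

end FPairs

/-! ### The three Fedder-type criteria -/

theorem proposition2p6 {R : Type*} [CommRing R] [IsRegularLocalRing R]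
    (p : ℕ) [Fact p.Prime] [CharP R p] (hF : FPairs.IsFFinite R p)
    (I : Ideal R) [I.IsPrime] [IsIntegrallyClosed (R ⧸ I)]
    (g : R) (hg : g ∉ I) (hred : (FPairs.divMk I g).IsReduced)
    (t : ℚ) (ht : 0 ≤ t) :
    (FPairs.IsFPure p (t • FPairs.divMk I g) (FPairs.smul_divMk_nonneg I g ht) ↔
      ∀ e : ℕ, 1 ≤ e →
        ¬ Ideal.span {g ^ ⌊t * ((p : ℚ) ^ e - 1)⌋₊} *
            (FPairs.frobeniusPower I (p ^ e)).colon (I : Set R) ≤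
          FPairs.frobeniusPower (IsLocalRing.maximalIdeal R) (p ^ e)) ∧
    (FPairs.IsStronglyFRegular p (t • FPairs.divMk I g) (FPairs.smul_divMk_nonneg I g ht) ↔
      ∀ c : R, c ∉ I → ∃ e : ℕ, 1 ≤ e ∧
        ¬ Ideal.span {c * g ^ ⌊t * ((p : ℚ) ^ e - 1)⌋₊} *
            (FPairs.frobeniusPower I (p ^ e)).colon (I : Set R) ≤
          FPairs.frobeniusPower (IsLocalRing.maximalIdeal R) (p ^ e)) ∧
    (FPairs.IsDivisoriallyFRegular p (FPairs.divMk I g) (FPairs.divMk_nonneg I g) ↔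
      ∀ c : R, c ∉ I → (∀ Q ∈ (I ⊔ Ideal.span {g}).minimalPrimes, c ∉ Q) →
        ∃ e : ℕ, 1 ≤ e ∧
          ¬ Ideal.span {c * g ^ (p ^ e - 1)} *
              (FPairs.frobeniusPower I (p ^ e)).colon (I : Set R) ≤
            FPairs.frobeniusPower (IsLocalRing.maximalIdeal R) (p ^ e)) := by
  have hq : ∀ e : ℕ, (0 : ℚ) ≤ (p : ℚ) ^ e - 1 := fun e =>
    sub_nonneg.2 (one_le_pow₀ (by exact_mod_cast (Fact.out : p.Prime).one_le))
  have hmk : Function.Surjective (Ideal.Quotient.mk I) := Ideal.Quotient.mk_surjective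
  have hsmul : ∀ e : ℕ, ((p : ℚ) ^ e - 1) • t • FPairs.divMk I g =
      (t * ((p : ℚ) ^ e - 1)) • FPairs.divMk I g := fun e => by rw [smul_smul, mul_comm]
  have hne : ∀ c : R, Ideal.Quotient.mk I c ≠ 0 ↔ c ∉ I := fun c =>
    Ideal.Quotient.eq_zero_iff_mem.not
  have hsplit := fun (e : ℕ) (c : R) => FPairs.splits_smul_divMk_iff p e hF I hg hred
    (mul_nonneg ht (hq e)) c
    (FPairs.qDivisor_nonneg p e (FPairs.smul_divMk_nonneg I g ht)) (hsmul e)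
  refine ⟨?_, ?_, ?_⟩
  · refine forall₂_congr fun e _ => ?_
    have := hsplit e 1
    rwa [map_one, one_mul] at this
  · rw [FPairs.IsStronglyFRegular, hmk.forall]
    exact forall_congr' fun c => imp_congr (hne c)
      (exists_congr fun e => and_congr_right fun _ => hsplit e c)
  · rw [FPairs.IsDivisoriallyFRegular, hmk.forall]
    refine forall_congr' fun c => imp_congr (hne c) (imp_congr ?_ ?_)
    · rw [show FPairs.roundDownIdeal (FPairs.divMk I g) = Ideal.span {Ideal.Quotient.mk I g} from
        FPairs.roundDownIdeal_div ((hne g).2 hg)]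
      -- The minimal primes of `I + gR` are thus the preimages of the minimal primes of `(ḡ)`.
      have h1 : I ⊔ Ideal.span {g} =
          (Ideal.span {Ideal.Quotient.mk I g}).comap (Ideal.Quotient.mk I) := by
        rw [← Set.image_singleton, ← Ideal.map_span, Ideal.comap_map_of_surjective _ hmk,
          ← RingHom.ker_eq_comap_bot, Ideal.mk_ker, sup_comm]
      rw [h1, Ideal.comap_minimalPrimes_eq_of_surjective hmk]
      simp
    · refine exists_congr fun e => and_congr_right fun _ => ?_
      -- Here `t = 1`; truncated subtraction in `p ^ e - 1` is harmless because `p ^ e ≥ 1`.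
      have hfl : ⌊(p : ℚ) ^ e - 1⌋₊ = p ^ e - 1 := by
        have h1 : 1 ≤ p ^ e := Nat.one_le_pow _ _ (Fact.out : p.Prime).pos
        rw [← Nat.floor_natCast (R := ℚ) (p ^ e - 1), Nat.cast_sub h1]
        push_cast
        rfl
      rw [← hfl]
      exact FPairs.splits_smul_divMk_iff p e hF I hg hred (hq e) c
        (FPairs.qDivisor_nonneg p e (FPairs.divMk_nonneg I g)) rfl
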